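/- Let $\kappa\in\mathbb{C}$, let $q>1$ be a real number, let $m$ be a positive integer, let $0<\beta<\alpha\le 1$, and let $\Phi_0,\dots,\Phi_{m-1}\colon\mathbb{R}\to\mathbb{C}$ be $1$-periodic Hölder continuous functions with exponent $\alpha$. Then there exist continuously differentiable $1$-periodic functions $\Psi_{-1},\Psi_0,\dots,\Psi_{m-1}\colon\mathbb{R}\to\mathbb{C}$ and a constant $c\in\mathbb{C}$ with the following properties. (1) For integers $N\to\infty$, $$\sum_{1\le n<N}n^\kappa\sum_{\substack{j+k=m-1\\0\le j<m}}\frac{(\log n)^k}{k!}\Phi_j(\log_q n) = c+N^{\kappa+1}\sum_{\substack{j+k=m-1\\-1\le j<m}}\frac{(\log N)^k}{k!}\Psi_j(\log_q N)+O\bigl(N^{\Re\kappa+1-\beta}\bigr).$$ (2) Let $\varphi_{j\ell}=\int_0^1\Phi_j(u)\exp(-2\ell\pi iu)\,\mathrm{d}u$ and $\psi_{j\ell}=\int_0^1\Psi_j(u)\exp(-2\ell\pi iu)\,\mathrm{d}u$ denote the Fourier coefficients. Then, for every $\ell\in\mathbb{Z}$, $$\sum_{0\le j<m}\varphi_{j\ell}Z^j=\Bigl(\kappa+1+\frac{2\ell\pi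 i}{\log q}+Z\Bigr)\sum_{-1\le j<m}\psi_{j\ell}Z^j+O(Z^m)\qquad(Z\to0,\ Z\ne 0).$$ (3) If $q^{\kappa+1}\neq1$, then $\Psi_{-1}$ vanishes identically. -/

import Mathlib

open Filter Topology Asymptotics
open scoped NNReal Nat

/-- The `ℓ`-th Fourier coefficient `∫₀¹ f(u) exp(-2ℓπiu) du` of a function of period `1`. -/
noncomputable def periodicFourierCoeff (f : ℝ → ℂ) (ℓ : ℤ) : ℂ :=
  ∫ u in (0 : ℝ)..1, f u * Complex.exp (-2 * (ℓ : ℂ) * (Real.pi : ℂ) * Complex.I * (u : ℂ))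

/-! The summand extends to a function `F` on the positive reals, and `Ψ` is chosen so that the main
term `G` is an exact antiderivative of `F`. With `L = log q`, `a = L(κ+1)` and `ψ n = Ψ (n - 1)`,
the equation `G' = F` follows from the triangular system `ψ₀' = -a ψ₀`, `ψₙ₊₁' = L(Φₙ - ψₙ) - a
ψₙ₊₁`.

If `exp a ≠ 1`, each equation has a periodic solution, starting from `ψ₀ = 0`; this is (3). If `exp
a = 1`, the equation for `ψₙ₊₁` is resonant: its source must be orthogonal to `exp(a u)`. This is
arranged by adding a multiple of `exp(-a u)`, a periodic homogeneous solution, to `ψₙ`; hence the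
extra function `Ψ₋₁` (`exists_periodic_chain`).

For (1), Hölder continuity bounds the increments of `F` on `[n, n+1]`, so the sum differs from `G`
by a constant plus a power of `N` (`exists_norm_sum_sub_antideriv_le`). For (2), integrating the
system against characters gives recurrences that compare coefficients of powers of `Z`. -/

/-! ### Periodic solutions of the linear system -/

theorem hasDerivAt_exp_neg_mul (a : ℂ) (u : ℝ) :
    HasDerivAt (fun u : ℝ => Complex.exp (-a * u)) (-a * Complex.exp (-a * u)) u := by
  have h3 : HasDerivAt (fun u : ℝ => -a * (u : ℂ)) (-a) u := by
    simpa using (Complex.ofRealCLM.hasDerivAt (x := u)).const_mul (-a)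
  exact h3.cexp.congr_deriv (mul_comm _ _)

/-- If `y' = g - a y` and `C (exp a - 1) = ∫₀¹ g(s) exp(a s) ds`, then the solution with
`y 0 = C` is periodic. -/
theorem exists_periodic_solution (a : ℂ) (g : ℝ → ℂ) (hg : Continuous g)
    (hper : Function.Periodic g 1) (C : ℂ)
    (hC : C * (Complex.exp a - 1) = ∫ s in (0 : ℝ)..1, g s * Complex.exp (a * s)) :
    ∃ y : ℝ → ℂ, Function.Periodic y 1 ∧ ∀ u, HasDerivAt y (g u - a * y u) u := by
  set h : ℝ → ℂ := fun s => g s * Complex.exp (a * s) with hh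
  have hcont : Continuous h := by fun_prop
  have hint : ∀ x y : ℝ, IntervalIntegrable h MeasureTheory.volume x y :=
    fun x y => hcont.intervalIntegrable x y
  -- Variation of constants; `hC` says exactly that the values at 0 and 1 agree.
  refine ⟨fun u => Complex.exp (-a * u) * (C + ∫ s in (0 : ℝ)..u, h s), fun u => ?_, fun u => ?_⟩
  · have hshift : ∫ s in (1 : ℝ)..(u + 1), h s = Complex.exp a * ∫ s in (0 : ℝ)..u, h s := by
      have h1 := intervalIntegral.integral_comp_add_right (a := 0) (b := u) h 1
      rw [zero_add] at h1
      rw [← h1, ← intervalIntegral.integral_const_mul]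
      refine intervalIntegral.integral_congr fun s _ => ?_
      simp only [hh]
      rw [hper s]
      push_cast
      rw [mul_add, Complex.exp_add]
      ring_nf
    have hsplit := intervalIntegral.integral_add_adjacent_intervals (hint 0 1) (hint 1 (u + 1))
    have he : Complex.exp (-a) * Complex.exp a = 1 := by
      rw [← Complex.exp_add, neg_add_cancel, Complex.exp_zero]
    simp only
    rw [← hsplit, hshift, ← hC]
    push_cast
    rw [mul_add (-a), Complex.exp_add, mul_one]
    linear_combination Complex.exp (-a * u) * (C + ∫ s in (0 : ℝ)..u, h s) * he
  · have h1 : HasDerivAt (fun u : ℝ => C + ∫ s in (0 : ℝ)..u, h s) (h u) u :=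
      (intervalIntegral.integral_hasDerivAt_right (hint 0 u)
        hcont.aestronglyMeasurable.stronglyMeasurableAtFilter hcont.continuousAt).const_add C
    have he : Complex.exp (-a * u) * Complex.exp (a * u) = 1 := by
      rw [← Complex.exp_add, neg_mul, neg_add_cancel, Complex.exp_zero]
    refine ((hasDerivAt_exp_neg_mul a u).mul h1).congr_deriv ?_
    simp only [hh]
    linear_combination g u * he

theorem periodic_exp_neg_mul {a : ℂ} (ha : Complex.exp a = 1) :
    Function.Periodic (fun u : ℝ => Complex.exp (-a * u)) 1 := by
  intro u
  simp only
  push_cast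
  rw [mul_add, Complex.exp_add, mul_one, Complex.exp_neg a, ha, inv_one, mul_one]

/-- A multiple of the homogeneous solution `exp (-a u)` cancels the resonant Fourier mode. -/
theorem integral_sub_add_exp (a : ℂ) {f y : ℝ → ℂ} (hf : Continuous f) (hy : Continuous y) :
    ∫ u in (0 : ℝ)..1, (f u - (y u + (∫ s in (0 : ℝ)..1, (f s - y s) * Complex.exp (a * s)) *
      Complex.exp (-a * u))) * Complex.exp (a * u) = 0 := by
  set C := ∫ s in (0 : ℝ)..1, (f s - y s) * Complex.exp (a * s) with hC
  have : ∀ u : ℝ, (f u - (y u + C * Complex.exp (-a * u))) * Complex.exp (a * u) =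
      (f u - y u) * Complex.exp (a * u) - C := by
    intro u
    have he : Complex.exp (-a * u) * Complex.exp (a * u) = 1 := by
      rw [← Complex.exp_add, neg_mul, neg_add_cancel, Complex.exp_zero]
    linear_combination -C * he
  simp only [this]
  rw [intervalIntegral.integral_sub, ← hC]
  · simp
  · exact Continuous.intervalIntegrable (by fun_prop) _ _
  · simp

/-- The triangular system of periodic linear ODEs `ψ₀' = -a ψ₀`,
`ψₙ₊₁' = L (fₙ - ψₙ) - a ψₙ₊₁` has a periodic solution. -/
theorem exists_periodic_chain (a L : ℂ) (f : ℕ → ℝ → ℂ) (hf : ∀ n, Continuous (f n))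
    (hper : ∀ n, Function.Periodic (f n) 1) :
    ∃ ψ : ℕ → ℝ → ℂ, (∀ n, Function.Periodic (ψ n) 1) ∧
      (∀ u, HasDerivAt (ψ 0) (-a * ψ 0 u) u) ∧
      (∀ n u, HasDerivAt (ψ (n + 1)) (L * (f n u - ψ n u) - a * ψ (n + 1) u) u) ∧
      (Complex.exp a ≠ 1 → ∀ u, ψ 0 u = 0) := by
  -- Invariant of the recursion: at resonance, the source of the next equation already satisfies its
  -- solvability condition.
  let P : ℕ → (ℝ → ℂ) → Prop := fun n ψ => Continuous ψ ∧ Function.Periodic ψ 1 ∧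
    (Complex.exp a = 1 → ∫ u in (0 : ℝ)..1, (f n u - ψ u) * Complex.exp (a * u) = 0)
  have hcontE : Continuous fun u : ℝ => Complex.exp (-a * u) := by fun_prop
  have hzero : ∃ ψ, P 0 ψ ∧ (∀ u, HasDerivAt ψ (-a * ψ u) u) ∧
      (Complex.exp a ≠ 1 → ∀ u, ψ u = 0) := by
    by_cases ha : Complex.exp a = 1
    · set C := ∫ s in (0 : ℝ)..1, (f 0 s - (fun _ => (0 : ℂ)) s) * Complex.exp (a * s) with hC
      refine ⟨fun u => 0 + C * Complex.exp (-a * u), ⟨by fun_prop, ?_, fun _ => ?_⟩, ?_, ?_⟩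
      · intro u
        have := periodic_exp_neg_mul ha u
        simp only at this ⊢
        rw [this]
      · exact integral_sub_add_exp a (hf 0) continuous_const
      · intro u
        refine (((hasDerivAt_exp_neg_mul a u).const_mul C).const_add 0).congr_deriv ?_
        ring
      · exact fun h => absurd ha h
    · exact ⟨fun _ => 0, ⟨continuous_const, fun _ => rfl, fun h => absurd h ha⟩,
        fun u => by simpa using hasDerivAt_const u (0 : ℂ), fun _ _ => rfl⟩
  have hstep : ∀ n ψ, P n ψ → ∃ χ, P (n + 1) χ ∧
      ∀ u, HasDerivAt χ (L * (f n u - ψ u) - a * χ u) u := by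
    rintro n ψ ⟨hψc, hψp, hψi⟩
    have hgc : Continuous fun u => L * (f n u - ψ u) :=
      continuous_const.mul ((hf n).sub hψc)
    have hgp : Function.Periodic (fun u => L * (f n u - ψ u)) 1 := fun u => by
      simp only [hper n u, hψp u]
    by_cases ha : Complex.exp a = 1
    -- At resonance the condition on the initial value reads `0 = 0` by the invariant, so the value
    -- is free; 0 is taken, and the multiple `C` of `exp(-a u)` then restores the invariant.
    · obtain ⟨y, hyp, hy⟩ := exists_periodic_solution a _ hgc hgp 0 (by
        simp only [mul_assoc, intervalIntegral.integral_const_mul, hψi ha]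
        simp)
      have hyc : Continuous y := continuous_iff_continuousAt.2 fun u => (hy u).continuousAt
      set C := ∫ s in (0 : ℝ)..1, (f (n + 1) s - y s) * Complex.exp (a * s) with hC
      refine ⟨fun u => y u + C * Complex.exp (-a * u), ⟨by fun_prop, ?_, fun _ => ?_⟩, ?_⟩
      · intro u
        have := periodic_exp_neg_mul ha u
        simp only at this ⊢
        rw [this, hyp u]
      · exact integral_sub_add_exp a (hf (n + 1)) hyc
      · intro u
        refine ((hy u).add ((hasDerivAt_exp_neg_mul a u).const_mul C)).congr_deriv ?_
        ring
    · obtain ⟨y, hyp, hy⟩ := exists_periodic_solution a _ hgc hgp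
        ((∫ s in (0 : ℝ)..1, (L * (f n s - ψ s)) * Complex.exp (a * s)) / (Complex.exp a - 1))
        (div_mul_cancel₀ _ (sub_ne_zero.2 ha))
      exact ⟨y, ⟨continuous_iff_continuousAt.2 fun u => (hy u).continuousAt, hyp,
        fun h => absurd h ha⟩, hy⟩
  obtain ⟨ψ₀, hP₀, hd₀, hz₀⟩ := hzero
  choose next hP hd using hstep
  let ψ : (n : ℕ) → {χ : ℝ → ℂ // P n χ} := fun n =>
    Nat.rec ⟨ψ₀, hP₀⟩ (fun n χ => ⟨next n χ.1 χ.2, hP n χ.1 χ.2⟩) n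
  exact ⟨fun n => (ψ n).1, fun n => (ψ n).2.2.1, hd₀, fun n => hd n (ψ n).1 (ψ n).2, hz₀⟩

/-! ### Fourier coefficients and the identity in `Z` -/

/-- Fourier coefficients of a periodic solution of `y' = g - a y`. -/
theorem periodicFourierCoeff_of_hasDerivAt (a : ℂ) {g y : ℝ → ℂ} (hg : Continuous g)
    (hyp : Function.Periodic y 1) (hy : ∀ u, HasDerivAt y (g u - a * y u) u) (ℓ : ℤ) :
    periodicFourierCoeff g ℓ =
      (a + 2 * (ℓ : ℂ) * (Real.pi : ℂ) * Complex.I) * periodicFourierCoeff y ℓ := by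
  have hyc : Continuous y := continuous_iff_continuousAt.2 fun u => (hy u).continuousAt
  set b : ℂ := 2 * (ℓ : ℂ) * (Real.pi : ℂ) * Complex.I with hb
  have hb' : ∀ u : ℝ, -2 * (ℓ : ℂ) * (Real.pi : ℂ) * Complex.I * (u : ℂ) = -b * u := fun u => by
    rw [hb]; ring
  have hexp : Complex.exp b = 1 := by
    rw [hb, Complex.exp_eq_one_iff]
    exact ⟨ℓ, by ring⟩
  simp only [periodicFourierCoeff, hb']
  -- The derivative of a periodic function integrates to zero over a period.
  have hderiv : ∀ u ∈ Set.uIcc (0 : ℝ) 1, HasDerivAt (fun u : ℝ => y u * Complex.exp (-b * u))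
      (g u * Complex.exp (-b * u) - (a + b) * (y u * Complex.exp (-b * u))) u := fun u _ =>
    ((hy u).mul (hasDerivAt_exp_neg_mul b u)).congr_deriv (by ring)
  have hint := intervalIntegral.integral_eq_sub_of_hasDerivAt hderiv
    (Continuous.intervalIntegrable (by fun_prop) _ _)
  rw [intervalIntegral.integral_sub (Continuous.intervalIntegrable (by fun_prop) _ _)
    (Continuous.intervalIntegrable (by fun_prop) _ _), intervalIntegral.integral_const_mul] at hint
  have h1 := periodic_exp_neg_mul hexp 0
  have h2 := hyp 0
  simp only [zero_add] at h1 h2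
  rw [h1, h2, sub_self] at hint
  exact sub_eq_zero.1 hint

/-- Multiplication of a truncated Laurent polynomial by `A + Z`. -/
theorem sum_sub_mul_sum_zpow (A : ℂ) (w ψ : ℕ → ℂ) (h0 : A * ψ 0 = 0)
    (hsucc : ∀ j, w j = A * ψ (j + 1) + ψ j) {Z : ℂ} (hZ : Z ≠ 0) (m : ℕ) :
    (∑ j ∈ Finset.range m, w j * Z ^ j) -
      (A + Z) * ∑ i ∈ Finset.range (m + 1), ψ i * Z ^ ((i : ℤ) - 1) = -ψ m * Z ^ m := by
  -- The pole at `Z = 0` is killed by `h0`; afterwards each new coefficient cancels the previous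
  -- remainder and leaves the next.
  induction m with
  | zero =>
    simp only [Finset.range_zero, Finset.sum_empty, zero_add, Finset.range_one,
      Finset.sum_singleton, Nat.cast_zero, zero_sub, zpow_neg_one, pow_zero]
    field_simp
    linear_combination -h0
  | succ m ih =>
    rw [Finset.sum_range_succ, Finset.sum_range_succ (fun i => ψ i * Z ^ ((i : ℤ) - 1)), hsucc m]
    have hz : Z ^ (((m + 1 : ℕ) : ℤ) - 1) = Z ^ m := by
      push_cast
      rw [add_sub_cancel_right, zpow_natCast]
    rw [hz]
    linear_combination ih

theorem sum_Ico_neg_one (m : ℕ) (f : ℤ → ℂ) :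
    ∑ j ∈ Finset.Ico (-1 : ℤ) (m : ℤ), f j = ∑ i ∈ Finset.range (m + 1), f ((i : ℤ) - 1) := by
  symm
  refine Finset.sum_bij (fun i _ => (i : ℤ) - 1) ?_ ?_ ?_ ?_
  · intro i hi
    simp only [Finset.mem_range, Finset.mem_Ico] at hi ⊢
    omega
  · intro i _ j _ h
    omega
  · intro j hj
    simp only [Finset.mem_Ico] at hj
    exact ⟨(j + 1).toNat, by simp only [Finset.mem_range]; omega, by omega⟩
  · exact fun _ _ => rfl

/-! ### Growth and increment estimates -/

/-- Growth of order `t ^ r` together with increments of order `t ^ (r - α)` on `[t, t + 1]`. -/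
def SlowlyIncreasing (α r : ℝ) (f : ℝ → ℂ) : Prop :=
  ∃ K : ℝ, 0 ≤ K ∧ ∀ t x : ℝ, 1 ≤ t → t ≤ x → x ≤ t + 1 →
    ‖f x‖ ≤ K * t ^ r ∧ ‖f x - f t‖ ≤ K * t ^ (r - α)

namespace SlowlyIncreasing

variable {α r s : ℝ} {f g : ℝ → ℂ}

theorem mono (hf : SlowlyIncreasing α r f) (hrs : r ≤ s) : SlowlyIncreasing α s f := by
  obtain ⟨K, hK, h⟩ := hf
  refine ⟨K, hK, fun t x ht h1 h2 => ⟨(h t x ht h1 h2).1.trans ?_, (h t x ht h1 h2).2.trans ?_⟩⟩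
  · gcongr
  · gcongr

theorem add (hf : SlowlyIncreasing α r f) (hg : SlowlyIncreasing α r g) :
    SlowlyIncreasing α r (fun x => f x + g x) := by
  obtain ⟨K, hK, h⟩ := hf
  obtain ⟨M, hM, h'⟩ := hg
  refine ⟨K + M, by positivity, fun t x ht h1 h2 => ⟨?_, ?_⟩⟩
  · rw [add_mul]
    exact (norm_add_le _ _).trans (add_le_add (h t x ht h1 h2).1 (h' t x ht h1 h2).1)
  · rw [add_mul, add_sub_add_comm]
    exact (norm_add_le _ _).trans (add_le_add (h t x ht h1 h2).2 (h' t x ht h1 h2).2)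

theorem mul (hf : SlowlyIncreasing α r f) (hg : SlowlyIncreasing α s g) :
    SlowlyIncreasing α (r + s) (fun x => f x * g x) := by
  obtain ⟨K, hK, h⟩ := hf
  obtain ⟨M, hM, h'⟩ := hg
  refine ⟨2 * (K * M), by positivity, fun t x ht h1 h2 => ?_⟩
  have ht0 : 0 < t := by linarith
  obtain ⟨hf1, hf2⟩ := h t x ht h1 h2
  obtain ⟨hg1, hg2⟩ := h' t x ht h1 h2
  have hft := (h t t ht le_rfl (by linarith)).1
  constructor
  · rw [norm_mul, Real.rpow_add ht0]
    calc ‖f x‖ * ‖g x‖ ≤ (K * t ^ r) * (M * t ^ s) := by gcongr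
      _ ≤ 2 * ((K * t ^ r) * (M * t ^ s)) := by
        have : 0 ≤ (K * t ^ r) * (M * t ^ s) := by positivity
        linarith
      _ = _ := by ring
  · have hsplit : f x * g x - f t * g t = (f x - f t) * g x + f t * (g x - g t) := by ring
    rw [hsplit]
    calc ‖(f x - f t) * g x + f t * (g x - g t)‖
        ≤ ‖f x - f t‖ * ‖g x‖ + ‖f t‖ * ‖g x - g t‖ := by
          refine (norm_add_le _ _).trans ?_
          rw [norm_mul, norm_mul]
      _ ≤ (K * t ^ (r - α)) * (M * t ^ s) + (K * t ^ r) * (M * t ^ (s - α)) := by gcongr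
      _ = K * M * (t ^ (r - α) * t ^ s) + K * M * (t ^ r * t ^ (s - α)) := by ring
      _ = 2 * (K * M) * t ^ (r + s - α) := by
        rw [← Real.rpow_add ht0, ← Real.rpow_add ht0]
        ring_nf

theorem const (c : ℂ) : SlowlyIncreasing α 0 (fun _ => c) :=
  ⟨‖c‖, norm_nonneg _, fun t x ht _ _ => ⟨by simp, by
    rw [sub_self, norm_zero]
    have : 0 < t := by linarith
    positivity⟩⟩

theorem sum {ι : Type*} (S : Finset ι) {F : ι → ℝ → ℂ} (hr : 0 ≤ r)
    (h : ∀ i ∈ S, SlowlyIncreasing α r (F i)) :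
    SlowlyIncreasing α r (fun x => ∑ i ∈ S, F i x) := by
  classical
  induction S using Finset.induction_on with
  | empty => simpa using (const (0 : ℂ)).mono hr
  | insert i S hi ih =>
    simp only [Finset.sum_insert hi]
    exact (h i (Finset.mem_insert_self i S)).add
      (ih fun j hj => h j (Finset.mem_insert_of_mem hj))

theorem pow (hf : SlowlyIncreasing α r f) (k : ℕ) :
    SlowlyIncreasing α (k * r) (fun x => f x ^ k) := by
  induction k with
  | zero => simpa using const (1 : ℂ)
  | succ k ih =>
    simp only [pow_succ]
    have := ih.mul hf
    rwa [show (k : ℝ) * r + r = ((k + 1 : ℕ) : ℝ) * r by push_cast; ring] at this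

end SlowlyIncreasing

theorem Real.rpow_le_two_rpow_abs_mul {t x : ℝ} (r : ℝ) (ht : 1 ≤ t) (h1 : t ≤ x)
    (h2 : x ≤ t + 1) : x ^ r ≤ 2 ^ |r| * t ^ r := by
  have ht0 : 0 < t := by linarith
  have hx0 : 0 < x := by linarith
  have hdiv : x ^ r = (x / t) ^ r * t ^ r := by
    rw [Real.div_rpow hx0.le ht0.le, div_mul_cancel₀]
    positivity
  rw [hdiv]
  gcongr
  have h1' : 1 ≤ x / t := (one_le_div ht0).2 h1
  have h2' : x / t ≤ 2 := (div_le_iff₀ ht0).2 (by linarith)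
  calc (x / t) ^ r ≤ (x / t) ^ |r| := Real.rpow_le_rpow_of_exponent_le h1' (le_abs_self r)
    _ ≤ 2 ^ |r| := Real.rpow_le_rpow (by linarith) h2' (abs_nonneg r)

theorem Real.two_rpow_neg_abs_mul_le_rpow {t x : ℝ} (r : ℝ) (ht : 1 ≤ t) (h1 : t ≤ x)
    (h2 : x ≤ t + 1) : 2 ^ (-|r|) * t ^ r ≤ x ^ r := by
  have ht0 : 0 < t := by linarith
  have hx0 : 0 < x := by linarith
  have h := Real.rpow_le_two_rpow_abs_mul (-r) ht h1 h2
  rw [abs_neg, Real.rpow_neg hx0.le, Real.rpow_neg ht0.le] at h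
  have hp : 0 < x ^ r := by positivity
  have hq : 0 < t ^ r := by positivity
  have h2p : (0 : ℝ) < 2 ^ |r| := by positivity
  rw [Real.rpow_neg (by norm_num)]
  rw [← div_eq_mul_inv, inv_le_comm₀ hp (by positivity), inv_div] at h
  rwa [inv_mul_eq_div]

theorem Real.log_sub_log_le_inv {t x : ℝ} (ht : 1 ≤ t) (h1 : t ≤ x) (h2 : x ≤ t + 1) :
    Real.log x - Real.log t ≤ t⁻¹ := by
  have ht0 : 0 < t := by linarith
  have hx0 : 0 < x := by linarith
  rw [← Real.log_div hx0.ne' ht0.ne']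
  refine (Real.log_le_sub_one_of_pos (by positivity)).trans ?_
  rw [sub_le_iff_le_add, div_le_iff₀ ht0, add_mul, inv_mul_cancel₀ ht0.ne']
  linarith

/-- Any `ε > 0` pays for a logarithm; its increments are at most `t⁻¹ ≤ t ^ (ε - α)` because `α ≤
1`. -/
theorem slowlyIncreasing_log {α ε : ℝ} (hα1 : α ≤ 1) (hε : 0 < ε) :
    SlowlyIncreasing α ε (fun x => ((Real.log x : ℝ) : ℂ)) := by
  refine ⟨2 ^ |ε| / ε + 1, by positivity, fun t x ht h1 h2 => ⟨?_, ?_⟩⟩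
  · have ht0 : 0 < t := by linarith
    rw [Complex.norm_real, Real.norm_of_nonneg (Real.log_nonneg (by linarith))]
    calc Real.log x ≤ x ^ ε / ε := Real.log_le_rpow_div (by linarith) hε
      _ ≤ 2 ^ |ε| * t ^ ε / ε := by
        gcongr
        exact Real.rpow_le_two_rpow_abs_mul ε ht h1 h2
      _ = 2 ^ |ε| / ε * t ^ ε := by ring
      _ ≤ _ := by
        gcongr
        linarith
  · have ht0 : 0 < t := by linarith
    rw [← Complex.ofReal_sub, Complex.norm_real,
      Real.norm_of_nonneg (sub_nonneg.2 (Real.log_le_log ht0 h1))]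
    calc Real.log x - Real.log t ≤ t⁻¹ := Real.log_sub_log_le_inv ht h1 h2
      _ = t ^ (-1 : ℝ) := (Real.rpow_neg_one t).symm
      _ ≤ t ^ (ε - α) := Real.rpow_le_rpow_of_exponent_le ht (by linarith)
      _ = 1 * t ^ (ε - α) := (one_mul _).symm
      _ ≤ _ := by
        gcongr
        have : (0 : ℝ) ≤ 2 ^ |ε| / ε := by positivity
        linarith

theorem hasDerivAt_exp_mul_log (c : ℂ) {x : ℝ} (hx : 0 < x) :
    HasDerivAt (fun x : ℝ => Complex.exp (c * (Real.log x : ℝ)))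
      (c * Complex.exp ((c - 1) * (Real.log x : ℝ))) x := by
  have h1 : HasDerivAt (fun x : ℝ => c * ((Real.log x : ℝ) : ℂ)) (c * ((x⁻¹ : ℝ) : ℂ)) x :=
    (Real.hasDerivAt_log hx.ne').ofReal_comp.const_mul c
  refine h1.cexp.congr_deriv ?_
  have h2 : ((x⁻¹ : ℝ) : ℂ) = Complex.exp (-(Real.log x : ℝ)) := by
    rw [← Complex.ofReal_neg, ← Complex.ofReal_exp, Real.exp_neg, Real.exp_log hx]
  rw [h2, sub_mul, one_mul, sub_eq_add_neg, Complex.exp_add]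
  ring

theorem norm_exp_mul_log (c : ℂ) {x : ℝ} (hx : 0 < x) :
    ‖Complex.exp (c * (Real.log x : ℝ))‖ = x ^ c.re := by
  rw [Complex.norm_exp, Real.rpow_def_of_pos hx]
  simp [mul_comm]

theorem slowlyIncreasing_exp_mul_log {α : ℝ} (hα1 : α ≤ 1) (c : ℂ) :
    SlowlyIncreasing α c.re (fun x => Complex.exp (c * (Real.log x : ℝ))) := by
  refine ⟨2 ^ |c.re| + ‖c‖ * 2 ^ |c.re - 1|, by positivity, fun t x ht h1 h2 => ?_⟩
  have ht0 : 0 < t := by linarith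
  have hx0 : 0 < x := by linarith
  constructor
  · rw [norm_exp_mul_log c hx0]
    refine (Real.rpow_le_two_rpow_abs_mul c.re ht h1 h2).trans ?_
    gcongr
    have : 0 ≤ ‖c‖ * 2 ^ |c.re - 1| := by positivity
    linarith
  · have hmv := norm_image_sub_le_of_norm_deriv_le_segment'
      (f := fun x : ℝ => Complex.exp (c * (Real.log x : ℝ)))
      (f' := fun x : ℝ => c * Complex.exp ((c - 1) * (Real.log x : ℝ)))
      (C := ‖c‖ * (2 ^ |c.re - 1| * t ^ (c.re - 1))) (a := t) (b := t + 1)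
      (fun y hy => (hasDerivAt_exp_mul_log c (ht0.trans_le hy.1)).hasDerivWithinAt)
      (fun y hy => by
        rw [norm_mul, norm_exp_mul_log _ (ht0.trans_le hy.1)]
        simp only [Complex.sub_re, Complex.one_re]
        gcongr
        exact Real.rpow_le_two_rpow_abs_mul _ ht hy.1 hy.2.le) x ⟨h1, h2⟩
    refine hmv.trans ?_
    calc ‖c‖ * (2 ^ |c.re - 1| * t ^ (c.re - 1)) * (x - t)
        ≤ ‖c‖ * (2 ^ |c.re - 1| * t ^ (c.re - 1)) * 1 := by gcongr; linarith
      _ = ‖c‖ * 2 ^ |c.re - 1| * t ^ (c.re - 1) := by ring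
      _ ≤ (2 ^ |c.re| + ‖c‖ * 2 ^ |c.re - 1|) * t ^ (c.re - α) := by
        gcongr
        · have : (0 : ℝ) ≤ 2 ^ |c.re| := by positivity
          linarith

/-- Periodicity gives boundedness. On `[t, t+1]` the argument `logb q x` moves by at most `1 / (t
log q)`, so the Hölder condition yields increments of order `t ^ (-α)`. -/
theorem slowlyIncreasing_holder_logb {α : ℝ≥0} {q : ℝ} (hq : 1 < q) {C : ℝ≥0} (hα : 0 < α)
    {f : ℝ → ℂ} (hf : HolderWith C α f) (hper : Function.Periodic f 1) :
    SlowlyIncreasing α 0 (fun x => f (Real.logb q x)) := by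
  have hlq : 0 < Real.log q := Real.log_pos hq
  obtain ⟨M, hM⟩ := (hper.isBounded_of_continuous one_ne_zero (hf.continuous hα)).exists_norm_le
  have hM0 : 0 ≤ M := (norm_nonneg _).trans (hM (f 0) ⟨0, rfl⟩)
  refine ⟨M + C * ((Real.log q)⁻¹) ^ (α : ℝ), by positivity, fun t x ht h1 h2 => ?_⟩
  have ht0 : 0 < t := by linarith
  constructor
  · rw [Real.rpow_zero, mul_one]
    have : (0 : ℝ) ≤ C * ((Real.log q)⁻¹) ^ (α : ℝ) := by positivity
    linarith [hM (f (Real.logb q x)) ⟨_, rfl⟩]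
  · have hd : dist (Real.logb q x) (Real.logb q t) ≤ (Real.log q)⁻¹ * t⁻¹ := by
      rw [Real.dist_eq, Real.logb, Real.logb, ← sub_div, abs_div, abs_of_pos hlq,
        abs_of_nonneg (sub_nonneg.2 (Real.log_le_log ht0 h1)), div_eq_inv_mul]
      gcongr
      exact Real.log_sub_log_le_inv ht h1 h2
    rw [← dist_eq_norm]
    calc dist (f (Real.logb q x)) (f (Real.logb q t))
        ≤ C * ((Real.log q)⁻¹ * t⁻¹) ^ (α : ℝ) := hf.dist_le_of_le hd
      _ = C * ((Real.log q)⁻¹) ^ (α : ℝ) * t ^ (0 - (α : ℝ)) := by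
        rw [Real.mul_rpow (by positivity) (by positivity), zero_sub, Real.rpow_neg ht0.le,
          Real.inv_rpow ht0.le]
        ring
      _ ≤ _ := by
        gcongr
        linarith

/-! ### Sums of error terms -/

theorem exists_norm_sum_sub_le_of_norm_le_sub {e : ℕ → ℂ} {b : ℕ → ℝ} (hb : ∀ n, 0 ≤ b n)
    (he : ∀ n, ‖e n‖ ≤ b n - b (n + 1)) :
    ∃ c : ℂ, ∀ N, ‖∑ n ∈ Finset.range N, e n - c‖ ≤ b N := by
  have htel : ∀ N M : ℕ, N ≤ M → ∑ n ∈ Finset.Ico N M, ‖e n‖ ≤ b N - b M := fun N M h => by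
    induction M, h using Nat.le_induction with
    | base => simp
    | succ M h ih =>
      rw [Finset.sum_Ico_succ_top h]
      linarith [he M]
  have hsum : Summable fun n => ‖e n‖ :=
    summable_of_sum_range_le (c := b 0) (fun n => norm_nonneg _) fun n => by
      have := htel 0 n n.zero_le
      rw [← Finset.range_eq_Ico] at this
      linarith [hb n]
  refine ⟨∑' n, e n, fun N => ?_⟩
  have hlim := hsum.of_norm.hasSum.tendsto_sum_nat
  refine le_of_tendsto ((tendsto_const_nhds.sub hlim).norm) ?_
  filter_upwards [eventually_ge_atTop N] with M hM
  rw [norm_sub_rev, ← Finset.sum_Ico_eq_sub _ hM]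
  exact (norm_sum_le _ _).trans ((htel N M hM).trans (by linarith [hb M]))

/-- `t ^ (r - 1)` is dominated by the increments of `t ^ r / r`. -/
theorem Real.rpow_sub_one_le_increment {r : ℝ} (hr : r ≠ 0) {t : ℝ} (ht : 1 ≤ t) :
    t ^ (r - 1) ≤ 2 ^ |r - 1| * (((t + 1) ^ r - t ^ r) / r) := by
  have ht0 : 0 < t := by linarith
  have hderiv : ∀ x : ℝ, 0 < x → HasDerivAt (fun x : ℝ => x ^ r / r) (x ^ (r - 1)) x :=
    fun x hx => ((Real.hasDerivAt_rpow_const (Or.inl hx.ne')).div_const r).congr_deriv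
      (mul_div_cancel_left₀ _ hr)
  obtain ⟨x, hx, hx'⟩ := exists_hasDerivAt_eq_slope (fun x : ℝ => x ^ r / r)
    (fun x => x ^ (r - 1)) (lt_add_one t)
    (fun x hx => (hderiv x (ht0.trans_le hx.1)).continuousAt.continuousWithinAt)
    (fun x hx => hderiv x (ht0.trans hx.1))
  rw [add_sub_cancel_left, div_one, ← sub_div] at hx'
  rw [← hx']
  have h := Real.two_rpow_neg_abs_mul_le_rpow (r - 1) ht hx.1.le hx.2.le
  rwa [Real.rpow_neg (by norm_num), inv_mul_le_iff₀ (by positivity)] at h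

/-- For `r < 0` the series converges, `c` is its sum and its tail is bounded by telescoping; for `r
> 0` the partial sums themselves are small enough and `c = 0`. The value `r = 0` would produce a
logarithm. -/
theorem exists_norm_sum_sub_le_rpow {e : ℕ → ℂ} {K r : ℝ} (hK : 0 ≤ K) (hr : r ≠ 0)
    (he : ∀ n : ℕ, 1 ≤ n → ‖e n‖ ≤ K * (n : ℝ) ^ (r - 1)) :
    ∃ (c : ℂ) (M : ℝ), ∀ N : ℕ, 1 ≤ N → ‖∑ n ∈ Finset.Ico 1 N, e n - c‖ ≤ M * (N : ℝ) ^ r := by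
  have hinc : ∀ n : ℕ, 1 ≤ n →
      ‖e n‖ ≤ K * 2 ^ |r - 1| / r * ((n : ℝ) + 1) ^ r - K * 2 ^ |r - 1| / r * (n : ℝ) ^ r := by
    intro n hn
    have hn' : (1 : ℝ) ≤ n := by exact_mod_cast hn
    refine (he n hn).trans ((mul_le_mul_of_nonneg_left
      (Real.rpow_sub_one_le_increment hr hn') hK).trans_eq ?_)
    ring
  rcases hr.lt_or_gt with hr | hr
  · set M := K * 2 ^ |r - 1| / (-r) with hM
    have hM0 : 0 ≤ M := div_nonneg (by positivity) (by linarith)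
    have hMr : K * 2 ^ |r - 1| / r = -M := by rw [hM, div_neg, neg_neg]
    obtain ⟨c, hc⟩ := exists_norm_sum_sub_le_of_norm_le_sub (e := fun n => e (n + 1))
      (b := fun n => M * ((n + 1 : ℕ) : ℝ) ^ r) (fun n => by positivity) (fun n => by
        have := hinc (n + 1) (by omega)
        rw [hMr] at this
        push_cast at this ⊢
        linarith)
    refine ⟨c, M, fun N hN => ?_⟩
    have := hc (N - 1)
    rw [Finset.sum_Ico_eq_sum_range]
    simp only [add_comm 1]
    rwa [Nat.sub_add_cancel hN] at this
  · refine ⟨0, K * 2 ^ |r - 1| / r, fun N hN => ?_⟩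
    rw [sub_zero]
    refine (norm_sum_le _ _).trans ?_
    induction N, hN using Nat.le_induction with
    | base => simpa using by positivity
    | succ N hN ih =>
      rw [Finset.sum_Ico_succ_top hN]
      have := hinc N hN
      push_cast
      linarith

/-! ### The exact antiderivative and comparison with the sum -/

theorem hasDerivAt_ofReal_pow_div_factorial (k : ℕ) (t : ℝ) :
    HasDerivAt (fun t : ℝ => (t : ℂ) ^ (k + 1) / ((k + 1) ! : ℂ)) ((t : ℂ) ^ k / (k ! : ℂ)) t := by
  have h : HasDerivAt (fun t : ℝ => (t : ℂ)) 1 t := (hasDerivAt_id t).ofReal_comp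
  refine ((h.pow (k + 1)).div_const _).congr_deriv ?_
  rw [Nat.factorial_succ, Nat.add_sub_cancel, mul_one]
  have h1 : ((k + 1 : ℕ) : ℂ) ≠ 0 := by exact_mod_cast k.succ_ne_zero
  have h2 : (k ! : ℂ) ≠ 0 := by exact_mod_cast k.factorial_ne_zero
  push_cast at h1 ⊢
  field_simp

/-- Differentiating a polynomial in `t` whose coefficients are the components of a solution of
the triangular system of ODEs. -/
theorem hasDerivAt_sum_antidiagonal (c : ℂ) {L : ℝ} (hL : L ≠ 0) {f ψ : ℕ → ℝ → ℂ}
    (h0 : ∀ u, HasDerivAt (ψ 0) (-(L * c) * ψ 0 u) u)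
    (hsucc : ∀ n u, HasDerivAt (ψ (n + 1)) (L * (f n u - ψ n u) - L * c * ψ (n + 1) u) u)
    (m : ℕ) (t : ℝ) :
    HasDerivAt
      (fun t : ℝ => ∑ p ∈ Finset.HasAntidiagonal.antidiagonal (m + 1),
        (t : ℂ) ^ p.2 / (p.2 ! : ℂ) * ψ p.1 (t / L))
      ((∑ p ∈ Finset.HasAntidiagonal.antidiagonal m, (t : ℂ) ^ p.2 / (p.2 ! : ℂ) * f p.1 (t / L))
        - c * ∑ p ∈ Finset.HasAntidiagonal.antidiagonal (m + 1),
          (t : ℂ) ^ p.2 / (p.2 ! : ℂ) * ψ p.1 (t / L)) t := by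
  -- `d k` is the derivative of `t ^ k / k!`, and `g n` is the source of the `n`-th equation divided
  -- by `L`. Both vanish at index 0, so shifting indices makes the sums of `ψ` without the factor
  -- `c` cancel.
  let d : ℕ → ℂ := fun k => Nat.casesOn k 0 fun k => (t : ℂ) ^ k / (k ! : ℂ)
  let g : ℕ → ℂ := fun n => Nat.casesOn n 0 fun n => f n (t / L) - ψ n (t / L)
  have hLc : (L : ℂ) ≠ 0 := by exact_mod_cast hL
  have hd : ∀ k, HasDerivAt (fun t : ℝ => (t : ℂ) ^ k / (k ! : ℂ)) (d k) t := by
    rintro (_ | k)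
    · simpa [d] using hasDerivAt_const t (1 : ℂ)
    · exact hasDerivAt_ofReal_pow_div_factorial k t
  have hdiv : HasDerivAt (fun t : ℝ => t / L) (L⁻¹) t := by
    simpa using (hasDerivAt_id t).div_const L
  have hψ : ∀ n, HasDerivAt (fun t : ℝ => ψ n (t / L)) (g n - c * ψ n (t / L)) t := by
    rintro (_ | n)
    · refine ((h0 (t / L)).scomp t hdiv).congr_deriv ?_
      rw [show g 0 = 0 from rfl, Complex.real_smul]
      push_cast
      field_simp
      ring
    · refine ((hsucc n (t / L)).scomp t hdiv).congr_deriv ?_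
      simp only [g, Complex.real_smul]
      push_cast
      field_simp
  refine (HasDerivAt.fun_sum fun p _ => (hd p.2).mul (hψ p.1)).congr_deriv ?_
  have e1 : ∑ p ∈ Finset.HasAntidiagonal.antidiagonal (m + 1), d p.2 * ψ p.1 (t / L) =
      ∑ p ∈ Finset.HasAntidiagonal.antidiagonal m,
        (t : ℂ) ^ p.2 / (p.2 ! : ℂ) * ψ p.1 (t / L) := by
    rw [Finset.Nat.sum_antidiagonal_succ' (f := fun p : ℕ × ℕ => d p.2 * ψ p.1 (t / L))]
    simp [d]
  have e2 : ∑ p ∈ Finset.HasAntidiagonal.antidiagonal (m + 1),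
      (t : ℂ) ^ p.2 / (p.2 ! : ℂ) * g p.1 =
      ∑ p ∈ Finset.HasAntidiagonal.antidiagonal m,
        (t : ℂ) ^ p.2 / (p.2 ! : ℂ) * (f p.1 (t / L) - ψ p.1 (t / L)) := by
    rw [Finset.Nat.sum_antidiagonal_succ
      (f := fun p : ℕ × ℕ => (t : ℂ) ^ p.2 / (p.2 ! : ℂ) * g p.1)]
    simp [g]
  simp only [mul_sub, Finset.sum_add_distrib, Finset.sum_sub_distrib] at e2 ⊢
  rw [e1, e2, Finset.mul_sum]
  simp only [mul_left_comm c]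
  ring

/-- An antiderivative of a slowly increasing function approximates its sum. -/
theorem exists_norm_sum_sub_antideriv_le {F G : ℝ → ℂ} {α r : ℝ}
    (hF : SlowlyIncreasing α (r - 1 + α) F) (hr : r ≠ 0)
    (hG : ∀ x, 0 < x → HasDerivAt G (F x) x) :
    ∃ (c : ℂ) (M : ℝ), ∀ N : ℕ, 1 ≤ N →
      ‖∑ n ∈ Finset.Ico 1 N, F n - (c + G N)‖ ≤ M * (N : ℝ) ^ r := by
  obtain ⟨K, hK, hF⟩ := hF
  obtain ⟨c, M, h⟩ := exists_norm_sum_sub_le_rpow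
    (e := fun n : ℕ => F n - (G ((n : ℝ) + 1) - G n)) hK hr (fun n hn => by
      have hn' : (1 : ℝ) ≤ n := by exact_mod_cast hn
      -- The mean value inequality for `G x - x * F n` turns the increment bound on `F` into one on
      -- `F n - (G (n+1) - G n)`.
      have hmv := norm_image_sub_le_of_norm_deriv_le_segment'
        (f := fun x : ℝ => G x - x * F n) (f' := fun x => F x - F n)
        (C := K * (n : ℝ) ^ (r - 1)) (a := n) (b := (n : ℝ) + 1)
        (fun x hx => by
          have h1 : HasDerivAt (fun x : ℝ => (x : ℂ)) 1 x := (hasDerivAt_id x).ofReal_comp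
          have h2 := (hG x (by linarith [hx.1])).sub (h1.mul_const (F n))
          rw [one_mul] at h2
          exact h2.hasDerivWithinAt)
        (fun x hx => by
          have := (hF n x hn' hx.1 hx.2.le).2
          rwa [add_sub_cancel_right] at this) ((n : ℝ) + 1) ⟨by linarith, le_rfl⟩
      rw [add_sub_cancel_left, mul_one, norm_sub_rev] at hmv
      refine le_of_eq_of_le (congrArg norm ?_) hmv
      push_cast
      ring)
  refine ⟨c - G 1, M, fun N hN => ?_⟩
  have htel : ∑ n ∈ Finset.Ico 1 N, (G ((n : ℝ) + 1) - G n) = G N - G 1 := by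
    have := Finset.sum_Ico_sub (fun n : ℕ => G n) hN
    push_cast at this
    exact this
  have := h N hN
  rw [Finset.sum_sub_distrib, htel] at this
  convert this using 2
  ring

/-! ### The main theorem -/

theorem mainTheorem2 (κ : ℂ) (q : ℝ) (hq : 1 < q) (m : ℕ) (hm : 0 < m)
    (α : ℝ≥0) (hα : 0 < α) (hα1 : α ≤ 1) (β : ℝ) (hβ : 0 < β) (hβα : β < (α : ℝ))
    (Φ : ℕ → ℝ → ℂ)
    (hΦper : ∀ j < m, Function.Periodic (Φ j) 1)
    (hΦ : ∀ j < m, ∃ C : ℝ≥0, HolderWith C α (Φ j)) :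
    ∃ (Ψ : ℤ → ℝ → ℂ) (c : ℂ),
      (∀ j : ℤ, -1 ≤ j → j < m → ContDiff ℝ 1 (Ψ j) ∧ Function.Periodic (Ψ j) 1) ∧
      -- the pairs `(j, k)` with `j + k = m - 1`, `0 ≤ j < m` on the left, and those with
      -- `j + k = m - 1`, `-1 ≤ j < m`, written as `(j + 1) + k = m`, on the right
      ((fun N : ℕ =>
          (∑ n ∈ Finset.Ico 1 N, (n : ℂ) ^ κ *
            ∑ p ∈ Finset.HasAntidiagonal.antidiagonal (m - 1),
              ((Real.log n : ℝ) : ℂ) ^ p.2 / (p.2 ! : ℂ) * Φ p.1 (Real.logb q n))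
          - (c + (N : ℂ) ^ (κ + 1) *
            ∑ p ∈ Finset.HasAntidiagonal.antidiagonal m,
              ((Real.log N : ℝ) : ℂ) ^ p.2 / (p.2 ! : ℂ) *
                Ψ ((p.1 : ℤ) - 1) (Real.logb q N)))
        =O[atTop] fun N : ℕ => (N : ℝ) ^ (κ.re + 1 - β)) ∧
      (∀ ℓ : ℤ,
        (fun Z : ℂ =>
          (∑ j ∈ Finset.range m, periodicFourierCoeff (Φ j) ℓ * Z ^ j)
          - (κ + 1 + 2 * (ℓ : ℂ) * (Real.pi : ℂ) * Complex.I / ((Real.log q : ℝ) : ℂ) + Z) *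
            ∑ j ∈ Finset.Ico (-1 : ℤ) (m : ℤ), periodicFourierCoeff (Ψ j) ℓ * Z ^ j)
        =O[𝓝[≠] 0] fun Z : ℂ => Z ^ m) ∧
      ((q : ℂ) ^ (κ + 1) ≠ 1 → ∀ u : ℝ, Ψ (-1) u = 0) := by
  set L := Real.log q with hLdef
  have hL : 0 < L := Real.log_pos hq
  have hLc : (L : ℂ) ≠ 0 := by exact_mod_cast hL.ne'
  -- Extension by zero allows the chain to run over all of `ℕ`; only `ψ 0, …, ψ m` matter.
  let f : ℕ → ℝ → ℂ := fun j => if j < m then Φ j else fun _ => 0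
  have hfΦ : ∀ j < m, f j = Φ j := fun j hj => if_pos hj
  have hfc : ∀ j, Continuous (f j) := fun j => by
    by_cases hj : j < m
    · rw [hfΦ j hj]
      exact (hΦ j hj).choose_spec.continuous hα
    · simpa only [f, if_neg hj] using continuous_const
  have hfp : ∀ j, Function.Periodic (f j) 1 := fun j => by
    by_cases hj : j < m
    · rw [hfΦ j hj]
      exact hΦper j hj
    · intro u
      simp only [f, if_neg hj]
  obtain ⟨ψ, hψp, hψ0, hψs, hψz⟩ := exists_periodic_chain (L * (κ + 1)) L f hfc hfp
  have hψdiff : ∀ n u, DifferentiableAt ℝ (ψ n) u := by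
    rintro (_ | n) u
    · exact (hψ0 u).differentiableAt
    · exact (hψs n u).differentiableAt
  have hψc : ∀ n, Continuous (ψ n) := fun n =>
    continuous_iff_continuousAt.2 fun u => (hψdiff n u).continuousAt
  have hψC1 : ∀ n, ContDiff ℝ 1 (ψ n) := fun n => by
    refine contDiff_one_iff_deriv.2 ⟨fun u => hψdiff n u, ?_⟩
    cases n with
    | zero =>
      rw [show deriv (ψ 0) = _ from funext fun u => (hψ0 u).deriv]
      exact continuous_const.mul (hψc 0)
    | succ n =>
      rw [show deriv (ψ (n + 1)) = _ from funext fun u => (hψs n u).deriv]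
      exact (continuous_const.mul ((hfc n).sub (hψc n))).sub (continuous_const.mul (hψc (n + 1)))
  have hindex : ∀ i : ℕ, ((i : ℤ) - 1 + 1).toNat = i := fun i => by omega
  -- an exponent strictly between `β` and `α` avoiding the logarithmic case
  obtain ⟨γ, hβγ, hγα, hγ⟩ : ∃ γ : ℝ, β < γ ∧ γ < α ∧ κ.re + 1 - γ ≠ 0 := by
    obtain ⟨γ, hγ1, hγ2⟩ := exists_between hβα
    by_cases h : κ.re + 1 - γ = 0
    · obtain ⟨δ, hδ1, hδ2⟩ := exists_between hγ1
      exact ⟨δ, hδ1, hδ2.trans hγ2, fun h' => by linarith⟩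
    · exact ⟨γ, hγ1, hγ2, h⟩
  let F : ℝ → ℂ := fun x => Complex.exp (κ * (Real.log x : ℝ)) *
    ∑ p ∈ Finset.HasAntidiagonal.antidiagonal (m - 1),
      ((Real.log x : ℝ) : ℂ) ^ p.2 / (p.2 ! : ℂ) * f p.1 (Real.logb q x)
  let G : ℝ → ℂ := fun x => Complex.exp ((κ + 1) * (Real.log x : ℝ)) *
    ∑ p ∈ Finset.HasAntidiagonal.antidiagonal m,
      ((Real.log x : ℝ) : ℂ) ^ p.2 / (p.2 ! : ℂ) * ψ p.1 (Real.logb q x)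
  have hFG : ∀ x, 0 < x → HasDerivAt G (F x) x := by
    intro x hx
    have h1 := hasDerivAt_exp_mul_log (κ + 1) hx
    have h2 := (hasDerivAt_sum_antidiagonal (κ + 1) hL.ne' hψ0 hψs (m - 1)
      (Real.log x)).scomp x (Real.hasDerivAt_log hx.ne')
    rw [Nat.sub_add_cancel hm] at h2
    refine (h1.mul h2).congr_deriv ?_
    have h3 : Complex.exp ((κ + 1) * (Real.log x : ℝ)) =
        Complex.exp (κ * (Real.log x : ℝ)) * x := by
      rw [add_mul, one_mul, Complex.exp_add, ← Complex.ofReal_exp, Real.exp_log hx]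
    have hxc : (x : ℂ) ≠ 0 := by exact_mod_cast hx.ne'
    simp only [F, Function.comp_apply, Complex.real_smul, add_sub_cancel_right, h3, Real.logb,
      ← hLdef]
    push_cast
    field_simp
    ring
  have hFslow : SlowlyIncreasing α (κ.re + 1 - γ - 1 + α) F := by
    -- Each logarithm costs this exponent; at most `m - 1` of them occur, so together they cost at
    -- most `α - γ`.
    have hδ : 0 < ((α : ℝ) - γ) / m := div_pos (by linarith) (by exact_mod_cast hm)
    have hα1' : (α : ℝ) ≤ 1 := by exact_mod_cast hα1
    have hsum : SlowlyIncreasing α (α - γ) (fun x =>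
        ∑ p ∈ Finset.HasAntidiagonal.antidiagonal (m - 1),
          ((Real.log x : ℝ) : ℂ) ^ p.2 / (p.2 ! : ℂ) * f p.1 (Real.logb q x)) := by
      refine SlowlyIncreasing.sum _ (by linarith) fun p hp => ?_
      have hp' : p.1 + p.2 = m - 1 := Finset.HasAntidiagonal.mem_antidiagonal.1 hp
      have hj : p.1 < m := by omega
      have hk : (p.2 : ℝ) ≤ m := by exact_mod_cast (by omega : p.2 ≤ m)
      obtain ⟨C, hC⟩ := hΦ p.1 hj
      have h := (((slowlyIncreasing_log hα1' hδ).pow p.2).mul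
        (SlowlyIncreasing.const ((p.2 ! : ℂ)⁻¹))).mul
          (slowlyIncreasing_holder_logb hq hα hC (hΦper p.1 hj))
      simp only [hfΦ p.1 hj, div_eq_mul_inv (_ ^ p.2)]
      refine h.mono ?_
      rw [add_zero, add_zero]
      calc (p.2 : ℝ) * ((α - γ) / m) ≤ m * ((α - γ) / m) := by gcongr
        _ = α - γ := mul_div_cancel₀ _ (by exact_mod_cast hm.ne')
    have := (slowlyIncreasing_exp_mul_log hα1' κ).mul hsum
    rwa [show κ.re + ((α : ℝ) - γ) = κ.re + 1 - γ - 1 + α by ring] at this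
  obtain ⟨c, M, hM⟩ := exists_norm_sum_sub_antideriv_le hFslow hγ hFG
  have hcpow : ∀ (n : ℕ) (s : ℂ), 1 ≤ n →
      (n : ℂ) ^ s = Complex.exp (s * (Real.log n : ℝ)) := fun n s hn => by
    rw [Complex.cpow_def_of_ne_zero (by exact_mod_cast (by omega : n ≠ 0)), mul_comm,
      Complex.ofReal_log n.cast_nonneg, Complex.ofReal_natCast]
  refine ⟨fun j => ψ (j + 1).toNat, c, fun j _ _ => ⟨hψC1 _, hψp _⟩, ?_, fun ℓ => ?_, ?_⟩
  · refine IsBigO.of_bound |M| ?_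
    filter_upwards [eventually_ge_atTop 1] with N hN
    have hN' : (1 : ℝ) ≤ N := by exact_mod_cast hN
    have hsum : ∑ n ∈ Finset.Ico 1 N, (n : ℂ) ^ κ *
        ∑ p ∈ Finset.HasAntidiagonal.antidiagonal (m - 1),
          ((Real.log n : ℝ) : ℂ) ^ p.2 / (p.2 ! : ℂ) * Φ p.1 (Real.logb q n) =
        ∑ n ∈ Finset.Ico 1 N, F n := by
      refine Finset.sum_congr rfl fun n hn => ?_
      rw [hcpow n κ (Finset.mem_Ico.1 hn).1]
      refine congrArg _ (Finset.sum_congr rfl fun p hp => ?_)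
      rw [hfΦ p.1 (by have := Finset.HasAntidiagonal.mem_antidiagonal.1 hp; omega)]
    simp only [hindex]
    rw [hsum, hcpow N _ hN, Real.norm_of_nonneg (by positivity)]
    refine (hM N hN).trans ?_
    gcongr
    exact le_abs_self M
  · set A : ℂ := κ + 1 + 2 * (ℓ : ℂ) * (Real.pi : ℂ) * Complex.I / (L : ℂ) with hA
    have hLA : L * A = L * (κ + 1) + 2 * (ℓ : ℂ) * (Real.pi : ℂ) * Complex.I := by
      rw [hA]
      field_simp
    -- The equation for `ψ 0` has no source.
    have h0 : A * periodicFourierCoeff (ψ 0) ℓ = 0 := by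
      have h := periodicFourierCoeff_of_hasDerivAt (L * (κ + 1)) (g := fun _ => 0)
        continuous_const (hψp 0) (fun u => (hψ0 u).congr_deriv (by ring)) ℓ
      rw [← hLA, mul_assoc] at h
      refine (mul_eq_zero.1 (h.symm.trans ?_)).resolve_left hLc
      simp [periodicFourierCoeff]
    have hs : ∀ j, periodicFourierCoeff (f j) ℓ =
        A * periodicFourierCoeff (ψ (j + 1)) ℓ + periodicFourierCoeff (ψ j) ℓ := by
      intro j
      have h := periodicFourierCoeff_of_hasDerivAt (L * (κ + 1))
        (g := fun u => L * (f j u - ψ j u)) (continuous_const.mul ((hfc j).sub (hψc j))) (hψp (j + 1)) (hψs j) ℓ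
      have hlin : periodicFourierCoeff (fun u => L * (f j u - ψ j u)) ℓ =
          L * (periodicFourierCoeff (f j) ℓ - periodicFourierCoeff (ψ j) ℓ) := by
        have hfj := hfc j
        have hψj := hψc j
        simp only [periodicFourierCoeff, mul_assoc (L : ℂ), sub_mul,
          intervalIntegral.integral_const_mul]
        rw [intervalIntegral.integral_sub (Continuous.intervalIntegrable (by fun_prop) _ _)
          (Continuous.intervalIntegrable (by fun_prop) _ _)]
      rw [hlin, ← hLA, mul_assoc] at h
      linear_combination mul_left_cancel₀ hLc h
    -- The difference is exactly `-Z ^ m` times this coefficient.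
    refine IsBigO.of_bound ‖periodicFourierCoeff (ψ m) ℓ‖ ?_
    filter_upwards [self_mem_nhdsWithin] with Z hZ
    rw [sum_Ico_neg_one]
    simp only [hindex]
    rw [Finset.sum_congr rfl fun j hj => by rw [← hfΦ j (Finset.mem_range.1 hj)],
      sum_sub_mul_sum_zpow A (fun j => periodicFourierCoeff (f j) ℓ)
        (fun j => periodicFourierCoeff (ψ j) ℓ) h0 hs hZ m, norm_mul, norm_neg]
  · intro hne u
    have hexp : (q : ℂ) ^ (κ + 1) = Complex.exp (L * (κ + 1)) := by
      rw [Complex.cpow_def_of_ne_zero (by exact_mod_cast (by linarith : q ≠ 0)),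
        Complex.ofReal_log (by linarith)]
    exact hψz (hexp ▸ hne) u
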